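/- A two-qubit state is a positive semidefinite matrix $\rho$ of trace one on $\mathbb C^2\otimes\mathbb C^2$; it is separable if it is a finite convex combination of product states $\sigma\otimes\tau$ of qubit states $\sigma,\tau$, and entangled otherwise. With the Pauli matrices $\sigma_x,\sigma_y,\sigma_z$ put $a_i=\operatorname{Tr}(\rho\,\sigma_i\otimes\mathbb 1)$, $b_j=\operatorname{Tr}(\rho\,\mathbb 1\otimes\sigma_j)$, $t_{ij}=\operatorname{Tr}(\rho\,\sigma_i\otimes\sigma_j)$, and $\|\mathbf a\|=\sqrt{\sum_i a_i^2}$, $\|\mathbf b\|=\sqrt{\sum_j b_j^2}$, $\|\mathbf T_{AB}\|=\sqrt{\sum_{i,j}t_{ij}^2}$. Define $$f(s)=\begin{cases}\sqrt{\tfrac16(2-3s^2)}, & s\le \tfrac23,\\ 1-s, & \tfrac23<s\le 1,\\ s-1, & s>1.\end{cases}$$ Then the following hold. 1. Every two-qubit state with $\|\mathbf T_{AB}\|\le f(\|\mathbf a\|+\|\mathbf b\|)$ is separable. 2. This is the strongest sufficient condition for separability in terms of $\|\mathbf a\|$, $\|\mathbf b\|$ and $\|\mathbf T_{AB}\|$: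 if $P$ is any condition on three real numbers such that every two-qubit state for which $P(\|\mathbf a\|,\|\mathbf b\|,\|\mathbf T_{AB}\|)$ holds is separable, then every two-qubit state for which $P(\|\mathbf a\|,\|\mathbf b\|,\|\mathbf T_{AB}\|)$ holds satisfies $\|\mathbf T_{AB}\|\le f(\|\mathbf a\|+\|\mathbf b\|)$. 3. There are entangled states arbitrarily close to the boundary: for all $x,y\in[0,1)$ and every $\varepsilon>0$ there is an entangled two-qubit state with $\|\mathbf a\|=x$, $\|\mathbf b\|=y$ and $f(x+y)<\|\mathbf T_{AB}\|<f(x+y)+\varepsilon$. -/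

import Mathlib

open scoped Kronecker ComplexOrder

namespace TwoQubit

/-- Density matrices: positive semidefinite complex matrices of trace one. -/
def IsState {n : Type*} [Fintype n] (ρ : Matrix n n ℂ) : Prop :=
  ρ.PosSemidef ∧ ρ.trace = 1

/-- The complex matrices acting on `ℂ² ⊗ ℂ²`; the index `(i, j)` is the basis vector `|i j⟩`. -/
abbrev Mat4 : Type := Matrix (Fin 2 × Fin 2) (Fin 2 × Fin 2) ℂ

/-- Separable: a finite convex combination of product states `σ ⊗ τ`. -/
def IsSeparable (ρ : Mat4) : Prop :=
  ρ ∈ convexHull ℝ {π : Mat4 | ∃ σ τ : Matrix (Fin 2) (Fin 2) ℂ,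
    IsState σ ∧ IsState τ ∧ π = σ ⊗ₖ τ}

/-- Entangled: a state that is not separable. -/
def IsEntangled (ρ : Mat4) : Prop :=
  IsState ρ ∧ ¬ IsSeparable ρ

/-- The Pauli matrices `σ_x, σ_y, σ_z`. -/
def pauli : Fin 3 → Matrix (Fin 2) (Fin 2) ℂ :=
  ![!![0, 1; 1, 0], !![0, -Complex.I; Complex.I, 0], !![1, 0; 0, -1]]

/-- The expectation value `Tr (ρ M)`; it is real when `ρ` and `M` are Hermitian, as in every use
below, so taking the real part loses nothing. -/
noncomputable def expect (ρ M : Mat4) : ℝ := (ρ * M).trace.re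

/-- The local Bloch vector `𝐚`, with `a_i = Tr (ρ σ_i ⊗ 1)`. -/
noncomputable def blochA (ρ : Mat4) (i : Fin 3) : ℝ :=
  expect ρ (pauli i ⊗ₖ (1 : Matrix (Fin 2) (Fin 2) ℂ))

/-- The local Bloch vector `𝐛`, with `b_j = Tr (ρ 1 ⊗ σ_j)`. -/
noncomputable def blochB (ρ : Mat4) (j : Fin 3) : ℝ :=
  expect ρ ((1 : Matrix (Fin 2) (Fin 2) ℂ) ⊗ₖ pauli j)

/-- The correlation tensor `𝐓`, with `t_ij = Tr (ρ σ_i ⊗ σ_j)`. -/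
noncomputable def corr (ρ : Mat4) (i j : Fin 3) : ℝ :=
  expect ρ (pauli i ⊗ₖ pauli j)

/-- The Bloch length `‖𝐚‖`. -/
noncomputable def lenA (ρ : Mat4) : ℝ := √(∑ i, blochA ρ i ^ 2)

/-- The Bloch length `‖𝐛‖`. -/
noncomputable def lenB (ρ : Mat4) : ℝ := √(∑ j, blochB ρ j ^ 2)

/-- The correlation tensor length `‖𝐓‖`. -/
noncomputable def lenT (ρ : Mat4) : ℝ := √(∑ i, ∑ j, corr ρ i j ^ 2)

/-- The piecewise bound on `‖𝐓‖`, as a function of `s = ‖𝐚‖ + ‖𝐛‖`. -/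
noncomputable def sepBound (s : ℝ) : ℝ :=
  if s ≤ 2 / 3 then √((2 - 3 * s ^ 2) / 6)
  else if s ≤ 1 then 1 - s
  else s - 1

end TwoQubit

/-!
A two-qubit state is described by its Bloch vectors `a`, `b` and its correlation tensor `T`, and a
product of pure states has the coordinates `(α, β, α βᵀ)` with unit vectors `α`, `β`. Write `x`,
`y`, `t` for the lengths of `a`, `b`, `T` and `s = x + y`.

*Sufficiency.* No criterion such as the partial transpose is needed. The convex hull of the product
coordinates is compact, so by Hahn–Banach (`IsState.isSeparable_of_forall_blockPos`) it is enough
that every form `w + u·α + v·β + αᵀSβ` that is nonnegative on unit vectors is nonnegative at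
`(a, b, T)`. Minimising over `β` gives `‖v + Sᵀα‖ ≤ w + u·α`; squaring and averaging over `α = ± e_i`
gives `‖S‖² + 3‖v‖² ≤ 3w² + ‖u‖²` (`BlockPos.sum_sq_le`), and the same with `u`, `v` exchanged.
Hence `c = max ‖u‖ ‖v‖` satisfies `c ≤ w` and `‖S‖² ≤ 3w² - 2c²`, and `c s + ‖S‖ t ≤ w` follows for
`s ≤ 1` from the definition of the bound (`add_mul_le_of_le_sepBound`). For `s > 1`, positivity of
the state along `-a`, `-b` and `t ≤ s - 1` force `T = (s - 1) a bᵀ / (x y)` (`BlockPos.nonneg_of_one_lt`).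

*Optimality.* Separable states satisfy the purity inequality `t² ≤ 1 - |x² - y²|`
(`IsSeparable.lenT_sq_le`). Conversely, every triple with `x, y < 1`, this inequality and
`t > sepBound s` belongs to an entangled state as well (`exists_isEntangled`), so no sufficient
condition in terms of the lengths can accept it; if `x = 1` or `y = 1`, the purity inequality itself
gives `t ≤ sepBound s`. The entangled states are X-states, with Bloch vectors along a common axis.
Their entanglement is detected by the partial transpose of the block spanned by `|01⟩` and `|10⟩`
(`IsSeparable.sq_corr_le`). The same states, with `t` chosen just above the bound, give the last
claim.
-/

/-! ### Convex hulls of compact sets -/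

/-- By Carathéodory's theorem, the hull is the image of a compact set of weights and points. -/
theorem isCompact_convexHull_of_finiteDimensional {E : Type*} [NormedAddCommGroup E]
    [NormedSpace ℝ E] [FiniteDimensional ℝ E] {s : Set E} (hs : IsCompact s) :
    IsCompact (convexHull ℝ s) := by
  rcases s.eq_empty_or_nonempty with rfl | ⟨c, hc⟩
  · simp
  set N := Module.finrank ℝ E + 1
  have hK : IsCompact ((fun q : (Fin N → ℝ) × (Fin N → E) => ∑ i, q.1 i • q.2 i) ''
      (stdSimplex ℝ (Fin N) ×ˢ Set.univ.pi fun _ => s)) :=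
    ((isCompact_stdSimplex ℝ (Fin N)).prod (isCompact_univ_pi fun _ => hs)).image (by fun_prop)
  convert! hK using 1
  apply Set.Subset.antisymm
  · intro x hx
    obtain ⟨ι, _, z, w, hz, hind, hw, hw1, rfl⟩ := eq_pos_convex_span_of_mem_convexHull hx
    have hcard : Fintype.card ι ≤ Fintype.card (Fin N) := by
      rw [Fintype.card_fin]
      exact hind.card_le_finrank_succ.trans (Nat.succ_le_succ (Submodule.finrank_le _))
    obtain ⟨e⟩ := Function.Embedding.nonempty_of_card_le hcard
    have hext (i : ι) : Function.extend e w 0 (e i) = w i := e.injective.extend_apply _ _ _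
    have hext' (i : ι) : Function.extend e z (fun _ => c) (e i) = z i :=
      e.injective.extend_apply _ _ _
    have hzero (j : Fin N) (hj : j ∉ Set.range e) : Function.extend e w 0 j = 0 :=
      Function.extend_apply' _ _ _ hj
    refine ⟨(Function.extend e w 0, Function.extend e z fun _ => c), ⟨⟨fun j => ?_, ?_⟩, ?_⟩, ?_⟩
    · by_cases hj : j ∈ Set.range e
      · obtain ⟨i, rfl⟩ := hj
        simpa only [hext] using (hw i).le
      · exact (hzero j hj).ge
    · rw [← hw1]
      exact (Fintype.sum_of_injective e e.injective _ _ hzero fun i => (hext i).symm).symm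
    · intro j _
      by_cases hj : j ∈ Set.range e
      · obtain ⟨i, rfl⟩ := hj
        simpa only [hext'] using hz ⟨i, rfl⟩
      · simpa only [Function.extend_apply' _ _ _ hj] using hc
    · refine (Fintype.sum_of_injective e e.injective _ _ (fun j hj => ?_) fun i => ?_).symm
      · simp [hzero j hj]
      · simp only [hext, hext']
  · rintro _ ⟨q, ⟨hq, hq'⟩, rfl⟩
    exact mem_convexHull_of_exists_fintype q.1 q.2 hq.1 hq.2 (fun i => hq' i trivial) rfl

namespace TwoQubit

/-! ### Block-positive forms -/

/-- Coefficients `(w, u, v, S)` in the Pauli basis of an observable whose expectation value in the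
product of the pure qubit states with Bloch vectors `α` and `β` is never negative. -/
def BlockPos (w : ℝ) (u v : Fin 3 → ℝ) (S : Fin 3 → Fin 3 → ℝ) : Prop :=
  ∀ α β : Fin 3 → ℝ, ∑ i, α i ^ 2 = 1 → ∑ j, β j ^ 2 = 1 →
    0 ≤ w + ∑ i, u i * α i + ∑ j, v j * β j + ∑ i, ∑ j, S i j * (α i * β j)

theorem BlockPos.swap {w : ℝ} {u v : Fin 3 → ℝ} {S : Fin 3 → Fin 3 → ℝ} (h : BlockPos w u v S) :
    BlockPos w v u (fun j i => S i j) := by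
  intro β α hβ hα
  have := h α β hα hβ
  rw [Finset.sum_comm] at this
  simp only [mul_comm (α _)] at this
  linarith

theorem sqrt_sum_sq_le_of_forall_unit {w : ℝ} {v : Fin 3 → ℝ}
    (h : ∀ β : Fin 3 → ℝ, ∑ j, β j ^ 2 = 1 → 0 ≤ w + ∑ j, v j * β j) : √(∑ j, v j ^ 2) ≤ w := by
  have h0 : 0 ≤ ∑ j, v j ^ 2 := Finset.sum_nonneg fun _ _ => sq_nonneg _
  rcases h0.eq_or_lt with h1 | h1
  · have hv : ∀ j, v j = 0 := fun j => by
      simpa using (Finset.sum_eq_zero_iff_of_nonneg fun _ _ => sq_nonneg _).1 h1.symm j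
        (Finset.mem_univ j)
    have := h ![1, 0, 0] (by simp [Fin.sum_univ_three])
    simpa [hv] using this
  · have hn := Real.sqrt_pos.2 h1
    have hsq := Real.sq_sqrt h0
    set n := √(∑ j, v j ^ 2)
    have := h (fun j => -v j / n) (by
      simp only [div_pow, neg_sq, ← Finset.sum_div]
      rw [← hsq, div_self (by positivity)])
    have hs : ∑ j, v j * (-v j / n) = -n := by
      have : ∀ j, v j * (-v j / n) = -(v j ^ 2 / n) := fun j => by ring
      simp only [this, Finset.sum_neg_distrib, ← Finset.sum_div]
      rw [← hsq]; field_simp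
    linarith

theorem BlockPos.sqrt_le {w : ℝ} {u v : Fin 3 → ℝ} {S : Fin 3 → Fin 3 → ℝ}
    (h : BlockPos w u v S) {α : Fin 3 → ℝ} (hα : ∑ i, α i ^ 2 = 1) :
    √(∑ j, (v j + ∑ i, S i j * α i) ^ 2) ≤ w + ∑ i, u i * α i := by
  refine sqrt_sum_sq_le_of_forall_unit fun β hβ => ?_
  have := h α β hα hβ
  rw [Finset.sum_comm] at this
  simp only [add_mul, Finset.sum_add_distrib, Finset.sum_mul, ← mul_assoc] at this ⊢
  linarith

theorem BlockPos.sqrt_left_le {w : ℝ} {u v : Fin 3 → ℝ} {S : Fin 3 → Fin 3 → ℝ}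
    (h : BlockPos w u v S) : √(∑ i, u i ^ 2) ≤ w :=
  sqrt_sum_sq_le_of_forall_unit fun _ hα => (Real.sqrt_nonneg _).trans (h.sqrt_le hα)

/-- Squaring `BlockPos.sqrt_le` and averaging over the six Bloch vectors `± e_i`. -/
theorem BlockPos.sum_sq_le {w : ℝ} {u v : Fin 3 → ℝ} {S : Fin 3 → Fin 3 → ℝ}
    (h : BlockPos w u v S) :
    ∑ i, ∑ j, S i j ^ 2 + 3 * ∑ j, v j ^ 2 ≤ 3 * w ^ 2 + ∑ i, u i ^ 2 := by
  have key (i : Fin 3) : ∑ j, S i j ^ 2 + ∑ j, v j ^ 2 ≤ w ^ 2 + u i ^ 2 := by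
    have h1 (c : ℝ) (hc : c ^ 2 = 1) : ∑ j, (v j + S i j * c) ^ 2 ≤ (w + u i * c) ^ 2 := by
      have := h.sqrt_le (α := Pi.single i c) (by simp [Pi.single_apply, hc])
      simp only [Pi.single_apply, mul_ite, mul_zero, Finset.sum_ite_eq', Finset.mem_univ,
        if_true] at this
      exact (Real.sqrt_le_left ((Real.sqrt_nonneg _).trans this)).1 this
    have hp := h1 1 (by norm_num)
    have hm := h1 (-1) (by norm_num)
    simp only [Fin.sum_univ_three] at hp hm ⊢
    linarith
  have := Finset.sum_le_sum fun i (_ : i ∈ Finset.univ) => key i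
  simp only [Finset.sum_add_distrib, Finset.sum_const, Finset.card_univ, Fintype.card_fin,
    nsmul_eq_mul] at this
  push_cast at this
  linarith

/-! ### The bound `sepBound` -/

/-- The bound is exactly dual to the constraints that `BlockPos.sum_sq_le` puts on the lengths of
the coefficient vectors: `c = w`, or the Cauchy–Schwarz optimum, is the worst case. -/
theorem add_mul_le_of_le_sepBound {w c σ s t : ℝ} (hc : 0 ≤ c) (hcw : c ≤ w)
    (h : σ ^ 2 ≤ 3 * w ^ 2 - 2 * c ^ 2) (hs : 0 ≤ s) (hs1 : s ≤ 1) (ht0 : 0 ≤ t)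
    (ht : t ≤ sepBound s) : c * s + σ * t ≤ w := by
  unfold sepBound at ht
  split_ifs at ht with h1
  · have h2 : 0 ≤ (2 - 3 * s ^ 2) / 6 := by nlinarith
    have ht2 : t ^ 2 ≤ (2 - 3 * s ^ 2) / 6 := (Real.le_sqrt ht0 h2).1 ht
    refine abs_le_of_sq_le_sq' ?_ (hc.trans hcw) |>.2
    -- Cauchy–Schwarz for `(√2 c, σ)` and `(s / √2, t)`
    have h3 : (c * s + σ * t) ^ 2 ≤ (2 * c ^ 2 + σ ^ 2) * (s ^ 2 / 2 + t ^ 2) := by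
      nlinarith [sq_nonneg (2 * c * t - σ * s)]
    have h4 : (2 * c ^ 2 + σ ^ 2) * (s ^ 2 / 2 + t ^ 2) ≤ (3 * w ^ 2) * (1 / 3) := by
      apply mul_le_mul <;> first | linarith | positivity
    linarith
  · -- the square roots of `3 w² - 2 c²` lie below their tangent at `c = w`
    have h2 : σ ≤ 3 * w - 2 * c := by
      refine abs_le_of_sq_le_sq' ?_ (by linarith) |>.2
      nlinarith [sq_nonneg (w - c)]
    have h3 : σ * t ≤ (3 * w - 2 * c) * (1 - s) :=
      (mul_le_mul_of_nonneg_right h2 ht0).trans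
        (mul_le_mul_of_nonneg_left ht (by linarith))
    nlinarith

theorem sepBound_of_one_lt {s : ℝ} (h : 1 < s) : sepBound s = s - 1 := by
  rw [sepBound, if_neg (by linarith), if_neg (by linarith)]

theorem sepBound_nonneg (s : ℝ) : 0 ≤ sepBound s := by
  unfold sepBound
  split_ifs <;> first | positivity | linarith

/-! ### Values of block-positive forms -/

theorem abs_sum_mul_le {ι : Type*} [Fintype ι] (f g : ι → ℝ) :
    |∑ i, f i * g i| ≤ √(∑ i, f i ^ 2) * √(∑ i, g i ^ 2) := by
  rw [← Real.sqrt_mul (Finset.sum_nonneg fun _ _ => sq_nonneg _)]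
  exact Real.abs_le_sqrt (Finset.sum_mul_sq_le_sq_mul_sq _ _ _)

theorem abs_sum_sum_mul_le {ι κ : Type*} [Fintype ι] [Fintype κ] (f g : ι → κ → ℝ) :
    |∑ i, ∑ j, f i j * g i j| ≤ √(∑ i, ∑ j, f i j ^ 2) * √(∑ i, ∑ j, g i j ^ 2) := by
  simp only [← Fintype.sum_prod_type']
  exact abs_sum_mul_le (fun p : ι × κ => f p.1 p.2) fun p => g p.1 p.2

theorem BlockPos.nonneg_of_le_sepBound {w : ℝ} {u v : Fin 3 → ℝ} {S : Fin 3 → Fin 3 → ℝ}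
    (h : BlockPos w u v S) {a b : Fin 3 → ℝ} {T : Fin 3 → Fin 3 → ℝ}
    (hs : √(∑ i, a i ^ 2) + √(∑ j, b j ^ 2) ≤ 1)
    (ht : √(∑ i, ∑ j, T i j ^ 2) ≤ sepBound (√(∑ i, a i ^ 2) + √(∑ j, b j ^ 2))) :
    0 ≤ w + ∑ i, u i * a i + ∑ j, v j * b j + ∑ i, ∑ j, S i j * T i j := by
  have hu := h.sqrt_left_le
  have hv := h.swap.sqrt_left_le
  have h1 := h.sum_sq_le
  have h2 := h.swap.sum_sq_le
  rw [Finset.sum_comm] at h2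
  have hua := (abs_le.1 (abs_sum_mul_le u a)).1
  have hvb := (abs_le.1 (abs_sum_mul_le v b)).1
  have hST := (abs_le.1 (abs_sum_sum_mul_le S T)).1
  have eu := Real.sq_sqrt (Finset.sum_nonneg fun i (_ : i ∈ Finset.univ) => sq_nonneg (u i))
  have ev := Real.sq_sqrt (Finset.sum_nonneg fun i (_ : i ∈ Finset.univ) => sq_nonneg (v i))
  have eS := Real.sq_sqrt (Finset.sum_nonneg fun i (_ : i ∈ Finset.univ) =>
    Finset.sum_nonneg fun j (_ : j ∈ Finset.univ) => sq_nonneg (S i j))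
  rw [← eu, ← ev, ← eS] at h1 h2
  have hx := Real.sqrt_nonneg (∑ i, a i ^ 2)
  have hy := Real.sqrt_nonneg (∑ j, b j ^ 2)
  have hU := Real.sqrt_nonneg (∑ i, u i ^ 2)
  have hV := Real.sqrt_nonneg (∑ i, v i ^ 2)
  set U := √(∑ i, u i ^ 2)
  set V := √(∑ i, v i ^ 2)
  set r := √(∑ i, ∑ j, S i j ^ 2)
  set x := √(∑ i, a i ^ 2)
  set y := √(∑ j, b j ^ 2)
  set t := √(∑ i, ∑ j, T i j ^ 2)
  have hmax : r ^ 2 ≤ 3 * w ^ 2 - 2 * max U V ^ 2 := by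
    rcases le_total U V with hUV | hUV
    · rw [max_eq_right hUV]; nlinarith
    · rw [max_eq_left hUV]; nlinarith
  have := add_mul_le_of_le_sepBound (hU.trans (le_max_left U V)) (max_le hu hv) hmax
    (add_nonneg hx hy) hs (Real.sqrt_nonneg _) ht
  have h3 := mul_le_mul_of_nonneg_right (le_max_left U V) hx
  have h4 := mul_le_mul_of_nonneg_right (le_max_right U V) hy
  nlinarith

/-- If `‖a‖ + ‖b‖ > 1`, the positivity of a state leaves room for only one matrix `T` with
`‖T‖ ≤ ‖a‖ + ‖b‖ - 1`. The state is then diagonal in a product basis. -/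
theorem BlockPos.nonneg_of_one_lt {w : ℝ} {u v : Fin 3 → ℝ} {S : Fin 3 → Fin 3 → ℝ}
    (h : BlockPos w u v S) {a b : Fin 3 → ℝ} {T : Fin 3 → Fin 3 → ℝ} (hρ : BlockPos 1 a b T)
    (hs : 1 < √(∑ i, a i ^ 2) + √(∑ j, b j ^ 2))
    (ht : √(∑ i, ∑ j, T i j ^ 2) ≤ √(∑ i, a i ^ 2) + √(∑ j, b j ^ 2) - 1) :
    0 ≤ w + ∑ i, u i * a i + ∑ j, v j * b j + ∑ i, ∑ j, S i j * T i j := by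
  have hx1 := hρ.sqrt_left_le
  have hy1 := hρ.swap.sqrt_left_le
  have hxsq := Real.sq_sqrt (Finset.sum_nonneg fun i (_ : i ∈ Finset.univ) => sq_nonneg (a i))
  have hysq := Real.sq_sqrt (Finset.sum_nonneg fun i (_ : i ∈ Finset.univ) => sq_nonneg (b i))
  have htsq := Real.sq_sqrt (Finset.sum_nonneg fun i (_ : i ∈ Finset.univ) =>
    Finset.sum_nonneg fun j (_ : j ∈ Finset.univ) => sq_nonneg (T i j))
  have ht0 := Real.sqrt_nonneg (∑ i, ∑ j, T i j ^ 2)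
  set x := √(∑ i, a i ^ 2)
  set y := √(∑ j, b j ^ 2)
  set t := √(∑ i, ∑ j, T i j ^ 2)
  have hx : 0 < x := by linarith
  have hy : 0 < y := by linarith
  obtain ⟨α, hα, ha⟩ : ∃ α : Fin 3 → ℝ, ∑ i, α i ^ 2 = 1 ∧ ∀ i, a i = x * α i := by
    refine ⟨fun i => a i / x, ?_, fun i => by field_simp⟩
    simp only [div_pow, ← Finset.sum_div]
    rw [← hxsq, div_self (by positivity)]
  obtain ⟨β, hβ, hb⟩ : ∃ β : Fin 3 → ℝ, ∑ i, β i ^ 2 = 1 ∧ ∀ i, b i = y * β i := by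
    refine ⟨fun i => b i / y, ?_, fun i => by field_simp⟩
    simp only [div_pow, ← Finset.sum_div]
    rw [← hysq, div_self (by positivity)]
  have hnα : ∑ i, (-α i) ^ 2 = 1 := by simpa using hα
  have hnβ : ∑ i, (-β i) ^ 2 = 1 := by simpa using hβ
  have hm := hρ (fun i => -α i) (fun j => -β j) hnα hnβ
  have hT : ∀ i j, T i j = (x + y - 1) * (α i * β j) := by
    have e1 : ∑ i, ∑ j, (T i j - (x + y - 1) * (α i * β j)) ^ 2 =
        t ^ 2 - 2 * (x + y - 1) * (∑ i, ∑ j, T i j * (α i * β j)) +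
          (x + y - 1) ^ 2 * ((∑ i, α i ^ 2) * ∑ j, β j ^ 2) := by
      rw [htsq]
      simp only [Fin.sum_univ_three]
      ring
    have e2 : x + y - 1 ≤ ∑ i, ∑ j, T i j * (α i * β j) := by
      have f1 : ∑ i, a i * -α i = -x := by
        trans -(x * ∑ i, α i ^ 2)
        · simp only [ha, Fin.sum_univ_three]
          ring
        · rw [hα, mul_one]
      have f2 : ∑ i, b i * -β i = -y := by
        trans -(y * ∑ i, β i ^ 2)
        · simp only [hb, Fin.sum_univ_three]
          ring
        · rw [hβ, mul_one]
      rw [f1, f2] at hm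
      simp only [neg_mul_neg] at hm
      linarith
    have e3 : ∑ i, ∑ j, (T i j - (x + y - 1) * (α i * β j)) ^ 2 = 0 := by
      refine le_antisymm ?_ (by positivity)
      rw [e1, hα, hβ]
      nlinarith
    intro i j
    have e4 := (Finset.sum_eq_zero_iff_of_nonneg fun i _ => by positivity).1 e3 i
      (Finset.mem_univ i)
    have e5 := (Finset.sum_eq_zero_iff_of_nonneg fun j _ => by positivity).1 e4 j
      (Finset.mem_univ j)
    exact sub_eq_zero.1 (pow_eq_zero_iff two_ne_zero |>.1 e5)
  -- the four weights are `(x + y) / 2`, `(1 - y) / 2`, `(1 - x) / 2` and `0`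
  have h1 := h α β hα hβ
  have h2 := h α (fun j => -β j) hα hnβ
  have h3 := h (fun i => -α i) β hnα hβ
  simp only [mul_neg, neg_mul, Finset.sum_neg_distrib] at h1 h2 h3
  have g1 : ∑ i, u i * a i = x * ∑ i, u i * α i := by
    rw [Finset.mul_sum]; exact Finset.sum_congr rfl fun i _ => by rw [ha]; ring
  have g2 : ∑ i, v i * b i = y * ∑ i, v i * β i := by
    rw [Finset.mul_sum]; exact Finset.sum_congr rfl fun i _ => by rw [hb]; ring
  have g3 : ∑ i, ∑ j, S i j * T i j = (x + y - 1) * ∑ i, ∑ j, S i j * (α i * β j) := by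
    simp only [Finset.mul_sum]
    exact Finset.sum_congr rfl fun i _ => Finset.sum_congr rfl fun j _ => by rw [hT]; ring
  rw [g1, g2, g3]
  have k1 := mul_nonneg (by linarith : 0 ≤ (x + y) / 2) h1
  have k2 := mul_nonneg (by linarith : 0 ≤ (1 - y) / 2) h2
  have k3 := mul_nonneg (by linarith : 0 ≤ (1 - x) / 2) h3
  linarith

/-! ### Bloch coordinates -/

/-- The `2 × 2` matrix `(1 + α · σ) / 2` with Bloch vector `α`, written out in entries. -/
noncomputable def qubit (α : Fin 3 → ℝ) : Matrix (Fin 2) (Fin 2) ℂ :=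
  !![(1 + α 2) / 2, (α 0 - Complex.I * α 1) / 2; (α 0 + Complex.I * α 1) / 2, (1 - α 2) / 2]

theorem trace_qubit (α : Fin 3 → ℝ) : (qubit α).trace = 1 := by
  simp [qubit, Matrix.trace_fin_two]
  ring

theorem qubit_isHermitian (α : Fin 3 → ℝ) : (qubit α).IsHermitian := by
  ext i j
  fin_cases i <;> fin_cases j <;> simp [qubit, ← sub_eq_add_neg]

/-- A unit Bloch vector belongs to a projection. -/
theorem posSemidef_qubit {α : Fin 3 → ℝ} (h : ∑ i, α i ^ 2 = 1) : (qubit α).PosSemidef := by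
  have hsq : (qubit α).conjTranspose * qubit α = qubit α := by
    rw [(qubit_isHermitian α).eq]
    have h' : (α 0 : ℂ) ^ 2 + (α 1 : ℂ) ^ 2 + (α 2 : ℂ) ^ 2 = 1 := by
      rw [Fin.sum_univ_three] at h
      exact_mod_cast h
    ext i j
    fin_cases i <;> fin_cases j <;> simp [qubit, Matrix.mul_apply]
    · linear_combination h' / 4 - (α 1 : ℂ) ^ 2 / 4 * Complex.I_sq
    · ring
    · ring
    · linear_combination h' / 4 - (α 1 : ℂ) ^ 2 / 4 * Complex.I_sq
  exact hsq ▸ Matrix.posSemidef_conjTranspose_mul_self (qubit α)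

theorem isState_qubit {α : Fin 3 → ℝ} (h : ∑ i, α i ^ 2 = 1) : IsState (qubit α) :=
  ⟨posSemidef_qubit h, trace_qubit α⟩

theorem IsState.exists_eq_qubit {σ : Matrix (Fin 2) (Fin 2) ℂ} (h : IsState σ) :
    ∃ α : Fin 3 → ℝ, ∑ i, α i ^ 2 ≤ 1 ∧ σ = qubit α := by
  obtain ⟨hpos, htr⟩ := h
  have h00 := hpos.1.apply 0 0
  have h11 := hpos.1.apply 1 1
  have h10 := hpos.1.apply 1 0
  rw [Matrix.trace_fin_two] at htr
  have hdet := hpos.det_nonneg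
  rw [Matrix.det_fin_two] at hdet
  simp only [Complex.ext_iff, Complex.le_def, Complex.star_def, Complex.conj_re, Complex.conj_im,
    Complex.add_re, Complex.add_im, Complex.one_re, Complex.one_im, Complex.sub_re,
    Complex.mul_re, Complex.zero_re] at h00 h11 h10 htr hdet
  have hσ : σ = qubit ![2 * (σ 0 1).re, -2 * (σ 0 1).im, (σ 0 0).re - (σ 1 1).re] := by
    ext i j
    fin_cases i <;> fin_cases j <;> apply Complex.ext <;> simp [qubit] <;> linarith
  refine ⟨_, ?_, hσ⟩
  simp only [Fin.sum_univ_three, Matrix.cons_val_zero, Matrix.cons_val_one, Matrix.cons_val]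
  have e1 : (σ 0 0).im = 0 := by linarith
  have e2 : (σ 1 1).im = 0 := by linarith
  rw [e1, e2, ← h10.1, ← h10.2] at hdet
  nlinarith

/-- The Hermitian matrix of trace one with Bloch vectors `a`, `b` and correlation tensor `T`. -/
noncomputable def ofBloch (a b : Fin 3 → ℝ) (T : Fin 3 → Fin 3 → ℝ) : Mat4 :=
  (1 / 4 : ℂ) • (1 + ∑ i, (a i : ℂ) • (pauli i ⊗ₖ (1 : Matrix (Fin 2) (Fin 2) ℂ)) +
    ∑ j, (b j : ℂ) • ((1 : Matrix (Fin 2) (Fin 2) ℂ) ⊗ₖ pauli j) +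
    ∑ i, ∑ j, (T i j : ℂ) • (pauli i ⊗ₖ pauli j))

theorem qubit_kronecker_qubit (α β : Fin 3 → ℝ) :
    qubit α ⊗ₖ qubit β = ofBloch α β fun i j => α i * β j := by
  ext ⟨i, j⟩ ⟨k, l⟩
  fin_cases i <;> fin_cases j <;> fin_cases k <;> fin_cases l <;>
    simp [ofBloch, qubit, pauli, Fin.sum_univ_three] <;> ring_nf <;> simp <;> ring

theorem trace_pauli (i : Fin 3) : (pauli i).trace = 0 := by
  fin_cases i <;> simp [pauli, Matrix.trace_fin_two]

theorem trace_pauli_mul_pauli (i j : Fin 3) :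
    (pauli i * pauli j).trace = if i = j then 2 else 0 := by
  fin_cases i <;> fin_cases j <;> simp [pauli, Matrix.trace_fin_two, one_add_one_eq_two]

theorem expect_ofBloch (a b : Fin 3 → ℝ) (T : Fin 3 → Fin 3 → ℝ)
    (A B : Matrix (Fin 2) (Fin 2) ℂ) :
    expect (ofBloch a b T) (A ⊗ₖ B) =
      (1 / 4 * (A.trace * B.trace + ∑ i, a i * ((pauli i * A).trace * B.trace) +
        ∑ j, b j * (A.trace * (pauli j * B).trace) +
        ∑ i, ∑ j, T i j * ((pauli i * A).trace * (pauli j * B).trace) : ℂ)).re := by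
  simp only [expect, ofBloch, Matrix.smul_mul, add_mul, Finset.sum_mul, one_mul,
    ← Matrix.mul_kronecker_mul, Matrix.trace_add, Matrix.trace_smul, Matrix.trace_sum,
    Matrix.trace_kronecker, smul_eq_mul]

theorem blochA_ofBloch (a b : Fin 3 → ℝ) (T : Fin 3 → Fin 3 → ℝ) : blochA (ofBloch a b T) = a := by
  ext k
  simp only [blochA, expect_ofBloch]
  simp [trace_pauli, trace_pauli_mul_pauli, -one_div]
  ring

theorem blochB_ofBloch (a b : Fin 3 → ℝ) (T : Fin 3 → Fin 3 → ℝ) : blochB (ofBloch a b T) = b := by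
  ext k
  simp only [blochB, expect_ofBloch]
  simp [trace_pauli, trace_pauli_mul_pauli, -one_div]
  ring

theorem corr_ofBloch (a b : Fin 3 → ℝ) (T : Fin 3 → Fin 3 → ℝ) : corr (ofBloch a b T) = T := by
  ext k l
  simp only [corr, expect_ofBloch]
  simp [trace_pauli, trace_pauli_mul_pauli, -one_div]
  ring

theorem blochA_eq (ρ : Mat4) : blochA ρ = ![
      (ρ (0, 0) (1, 0)).re + (ρ (0, 1) (1, 1)).re + (ρ (1, 0) (0, 0)).re + (ρ (1, 1) (0, 1)).re,
      -(ρ (0, 0) (1, 0)).im - (ρ (0, 1) (1, 1)).im + (ρ (1, 0) (0, 0)).im + (ρ (1, 1) (0, 1)).im,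
      (ρ (0, 0) (0, 0)).re + (ρ (0, 1) (0, 1)).re - (ρ (1, 0) (1, 0)).re -
        (ρ (1, 1) (1, 1)).re] := by
  ext i
  fin_cases i <;> simp [blochA, expect, pauli, Matrix.one_apply, Matrix.trace,
    Matrix.mul_apply, Fintype.sum_prod_type] <;> ring

theorem blochB_eq (ρ : Mat4) : blochB ρ = ![
      (ρ (0, 0) (0, 1)).re + (ρ (0, 1) (0, 0)).re + (ρ (1, 0) (1, 1)).re + (ρ (1, 1) (1, 0)).re,
      -(ρ (0, 0) (0, 1)).im + (ρ (0, 1) (0, 0)).im - (ρ (1, 0) (1, 1)).im + (ρ (1, 1) (1, 0)).im,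
      (ρ (0, 0) (0, 0)).re - (ρ (0, 1) (0, 1)).re + (ρ (1, 0) (1, 0)).re -
        (ρ (1, 1) (1, 1)).re] := by
  ext i
  fin_cases i <;> simp [blochB, expect, pauli, Matrix.one_apply, Matrix.trace,
    Matrix.mul_apply, Fintype.sum_prod_type] <;> ring

theorem corr_eq (ρ : Mat4) : corr ρ = ![
    ![(ρ (0, 0) (1, 1)).re + (ρ (0, 1) (1, 0)).re + (ρ (1, 0) (0, 1)).re + (ρ (1, 1) (0, 0)).re,
      -(ρ (0, 0) (1, 1)).im + (ρ (0, 1) (1, 0)).im - (ρ (1, 0) (0, 1)).im + (ρ (1, 1) (0, 0)).im,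
      (ρ (0, 0) (1, 0)).re - (ρ (0, 1) (1, 1)).re + (ρ (1, 0) (0, 0)).re - (ρ (1, 1) (0, 1)).re],
    ![-(ρ (0, 0) (1, 1)).im - (ρ (0, 1) (1, 0)).im + (ρ (1, 0) (0, 1)).im + (ρ (1, 1) (0, 0)).im,
      -(ρ (0, 0) (1, 1)).re + (ρ (0, 1) (1, 0)).re + (ρ (1, 0) (0, 1)).re - (ρ (1, 1) (0, 0)).re,
      -(ρ (0, 0) (1, 0)).im + (ρ (0, 1) (1, 1)).im + (ρ (1, 0) (0, 0)).im - (ρ (1, 1) (0, 1)).im],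
    ![(ρ (0, 0) (0, 1)).re + (ρ (0, 1) (0, 0)).re - (ρ (1, 0) (1, 1)).re - (ρ (1, 1) (1, 0)).re,
      -(ρ (0, 0) (0, 1)).im + (ρ (0, 1) (0, 0)).im + (ρ (1, 0) (1, 1)).im - (ρ (1, 1) (1, 0)).im,
      (ρ (0, 0) (0, 0)).re - (ρ (0, 1) (0, 1)).re - (ρ (1, 0) (1, 0)).re +
        (ρ (1, 1) (1, 1)).re]] := by
  ext i j
  fin_cases i <;> fin_cases j <;>
    simp [corr, expect, pauli, Matrix.trace, Matrix.mul_apply, Fintype.sum_prod_type] <;> ring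

set_option maxHeartbeats 4000000 in
theorem ofBloch_eq {ρ : Mat4} (h : ρ.IsHermitian) (htr : ρ.trace = 1) :
    ofBloch (blochA ρ) (blochB ρ) (corr ρ) = ρ := by
  have hh := fun p q => Complex.ext_iff.1 (h.apply p q)
  simp only [Complex.star_def, Complex.conj_re, Complex.conj_im] at hh
  simp only [Matrix.trace, Fintype.sum_prod_type, Fin.sum_univ_two, Matrix.diag_apply] at htr
  have htr' := congrArg Complex.re htr
  simp only [Complex.add_re, Complex.one_re] at htr'
  ext ⟨i, j⟩ ⟨k, l⟩
  have h00 := hh (0, 0) (0, 0)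
  have h01 := hh (0, 0) (0, 1)
  have h02 := hh (0, 0) (1, 0)
  have h03 := hh (0, 0) (1, 1)
  have h11 := hh (0, 1) (0, 1)
  have h12 := hh (0, 1) (1, 0)
  have h13 := hh (0, 1) (1, 1)
  have h22 := hh (1, 0) (1, 0)
  have h23 := hh (1, 0) (1, 1)
  have h33 := hh (1, 1) (1, 1)
  rw [blochA_eq, blochB_eq, corr_eq]
  fin_cases i <;> fin_cases j <;> fin_cases k <;> fin_cases l <;> apply Complex.ext <;>
    simp [ofBloch, pauli, Fin.sum_univ_three] <;> linarith

theorem expect_convex (ρ ρ' M : Mat4) (s t : ℝ) :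
    expect (s • ρ + t • ρ') M = s * expect ρ M + t * expect ρ' M := by
  simp [expect, add_mul, Matrix.trace_add, Matrix.trace_smul]

theorem expect_qubit_kronecker_qubit {ρ : Mat4} (h : IsState ρ) (α β : Fin 3 → ℝ) :
    expect ρ (qubit α ⊗ₖ qubit β) = 1 / 4 * (1 + ∑ i, blochA ρ i * α i + ∑ j, blochB ρ j * β j +
      ∑ i, ∑ j, corr ρ i j * (α i * β j)) := by
  simp only [blochA, blochB, corr]
  rw [qubit_kronecker_qubit]
  simp only [expect, ofBloch, Matrix.mul_smul, mul_add, mul_one, Finset.mul_sum, Matrix.trace_add,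
    Matrix.trace_smul, Matrix.trace_sum, smul_eq_mul, Complex.add_re, Complex.re_sum, h.2]
  have h4 : (1 / 4 : ℂ) = ((1 / 4 : ℝ) : ℂ) := by norm_num
  simp only [h4, Complex.re_ofReal_mul, Complex.ofReal_re, mul_comm, mul_left_comm]

open scoped MatrixOrder in
/-- Product projections have nonnegative expectation values. -/
theorem IsState.blockPos {ρ : Mat4} (h : IsState ρ) :
    BlockPos 1 (blochA ρ) (blochB ρ) (corr ρ) := by
  intro α β hα hβ
  have hsq := (posSemidef_qubit hα).kronecker (posSemidef_qubit hβ)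
  obtain ⟨B, hB⟩ := CStarAlgebra.nonneg_iff_eq_star_mul_self.1 hsq.nonneg
  have h0 : 0 ≤ expect ρ (qubit α ⊗ₖ qubit β) := by
    rw [expect, hB, Matrix.star_eq_conjTranspose, ← mul_assoc, Matrix.trace_mul_comm, ← mul_assoc]
    exact (Complex.le_def.1 (h.1.mul_mul_conjTranspose_same B).trace_nonneg).1
  rw [expect_qubit_kronecker_qubit h] at h0
  linarith

/-! ### Separability in Bloch coordinates -/

/-- A linear inequality that holds for all product states holds for all separable states. -/
theorem IsSeparable.nonneg_of_forall_product {ρ : Mat4} (hρ : IsSeparable ρ) {w : ℝ}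
    {u v : Fin 3 → ℝ} {S : Fin 3 → Fin 3 → ℝ}
    (h : ∀ α β : Fin 3 → ℝ, ∑ i, α i ^ 2 ≤ 1 → ∑ j, β j ^ 2 ≤ 1 →
      0 ≤ w + ∑ i, u i * α i + ∑ j, v j * β j + ∑ i, ∑ j, S i j * (α i * β j)) :
    0 ≤ w + ∑ i, u i * blochA ρ i + ∑ j, v j * blochB ρ j + ∑ i, ∑ j, S i j * corr ρ i j := by
  refine convexHull_min (t := {ρ : Mat4 | 0 ≤ w + ∑ i, u i * blochA ρ i + ∑ j, v j * blochB ρ j +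
    ∑ i, ∑ j, S i j * corr ρ i j}) ?_ ?_ hρ
  · rintro _ ⟨σ, τ, hσ, hτ, rfl⟩
    obtain ⟨α, hα, rfl⟩ := hσ.exists_eq_qubit
    obtain ⟨β, hβ, rfl⟩ := hτ.exists_eq_qubit
    simp only [Set.mem_ofPred_eq, qubit_kronecker_qubit, blochA_ofBloch, blochB_ofBloch,
      corr_ofBloch]
    exact h α β hα hβ
  · intro ρ₁ h₁ ρ₂ h₂ s t hs ht hst
    simp only [Set.mem_ofPred_eq] at h₁ h₂ ⊢
    have := add_nonneg (mul_nonneg hs h₁) (mul_nonneg ht h₂)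
    simp only [blochA, blochB, corr, expect_convex] at this ⊢
    refine this.trans_eq ?_
    simp only [mul_add, Finset.sum_add_distrib, Finset.mul_sum, mul_left_comm _ s,
      mul_left_comm _ t]
    linear_combination w * hst

theorem ofBloch_convex (a b a' b' : Fin 3 → ℝ) (T T' : Fin 3 → Fin 3 → ℝ) {s t : ℝ}
    (h : s + t = 1) :
    ofBloch (s • a + t • a') (s • b + t • b') (s • T + t • T') =
      s • ofBloch a b T + t • ofBloch a' b' T' := by
  have h1 : (1 : Mat4) = ((s : ℂ) + t) • (1 : Mat4) := by
    rw [← Complex.ofReal_add, h, Complex.ofReal_one, one_smul]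
  simp only [ofBloch, ← Complex.coe_smul]
  conv_lhs => rw [h1]
  simp only [Pi.add_apply, Pi.smul_apply, smul_eq_mul, Complex.ofReal_add, Complex.ofReal_mul,
    Fin.sum_univ_three]
  module

/-- The Bloch coordinates `(α, β, α βᵀ)` of the products of pure qubit states. -/
def pureProducts : Set ((Fin 3 → ℝ) × (Fin 3 → ℝ) × (Fin 3 → Fin 3 → ℝ)) :=
  (fun q : (Fin 3 → ℝ) × (Fin 3 → ℝ) => (q.1, q.2, fun i j => q.1 i * q.2 j)) ''
    ({α | ∑ i, α i ^ 2 = 1} ×ˢ {β | ∑ j, β j ^ 2 = 1})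

theorem isCompact_pureProducts : IsCompact pureProducts := by
  have h : IsCompact {α : Fin 3 → ℝ | ∑ i, α i ^ 2 = 1} := by
    refine IsCompact.of_isClosed_subset (isCompact_Icc (a := fun _ => (-1 : ℝ)) (b := fun _ => 1))
      (isClosed_eq (by fun_prop) continuous_const) fun α hα => ?_
    have h1 (i : Fin 3) : |α i| ≤ 1 := by
      rw [← sq_le_one_iff_abs_le_one]
      refine le_of_le_of_eq ?_ hα
      exact Finset.single_le_sum (f := fun i => α i ^ 2) (fun _ _ => sq_nonneg _)
        (Finset.mem_univ i)
    exact ⟨fun i => (abs_le.1 (h1 i)).1, fun i => (abs_le.1 (h1 i)).2⟩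
  exact (h.prod h).image (by fun_prop)

theorem isSeparable_ofBloch {a b : Fin 3 → ℝ} {T : Fin 3 → Fin 3 → ℝ}
    (h : (a, b, T) ∈ convexHull ℝ pureProducts) : IsSeparable (ofBloch a b T) := by
  have hsub : convexHull ℝ pureProducts ⊆ {e | IsSeparable (ofBloch e.1 e.2.1 e.2.2)} := by
    refine convexHull_min ?_ ?_
    · rintro _ ⟨⟨α, β⟩, ⟨hα, hβ⟩, rfl⟩
      rw [Set.mem_ofPred_eq, ← qubit_kronecker_qubit]
      exact subset_convexHull ℝ _ ⟨qubit α, qubit β, isState_qubit hα, isState_qubit hβ, rfl⟩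
    · intro e he e' he' s t hs ht hst
      rw [Set.mem_ofPred_eq] at he he' ⊢
      rw [Prod.fst_add, Prod.snd_add, Prod.fst_add, Prod.snd_add, Prod.smul_fst, Prod.smul_snd,
        Prod.smul_fst, Prod.smul_snd, Prod.smul_fst, Prod.smul_snd, Prod.smul_fst, Prod.smul_snd,
        ofBloch_convex _ _ _ _ _ _ hst]
      exact convex_convexHull ℝ _ he he' hs ht hst
  have := hsub h
  rwa [Set.mem_ofPred_eq] at this

/-- Hahn–Banach: a state on which no block-positive form is negative is separable. -/
theorem IsState.isSeparable_of_forall_blockPos {ρ : Mat4} (hρ : IsState ρ)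
    (h : ∀ w u v S, BlockPos w u v S →
      0 ≤ w + ∑ i, u i * blochA ρ i + ∑ j, v j * blochB ρ j + ∑ i, ∑ j, S i j * corr ρ i j) :
    IsSeparable ρ := by
  rw [← ofBloch_eq hρ.1.1 hρ.2]
  refine isSeparable_ofBloch (by_contra fun hmem => ?_)
  obtain ⟨f, c, hfρ, hf⟩ := geometric_hahn_banach_point_closed (convex_convexHull ℝ pureProducts)
    (isCompact_convexHull_of_finiteDimensional isCompact_pureProducts).isClosed hmem
  have hcoord (a b : Fin 3 → ℝ) (T : Fin 3 → Fin 3 → ℝ) : f (a, b, T) =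
      ∑ i, f (Pi.single i 1, 0, 0) * a i + ∑ j, f (0, Pi.single j 1, 0) * b j +
        ∑ i, ∑ j, f (0, 0, Pi.single i (Pi.single j 1)) * T i j := by
    have hdec : (a, b, T) = ∑ i, a i • ((Pi.single i 1, 0, 0) :
          (Fin 3 → ℝ) × (Fin 3 → ℝ) × (Fin 3 → Fin 3 → ℝ)) +
        ∑ j, b j • (0, Pi.single j 1, 0) +
        ∑ i, ∑ j, T i j • (0, 0, Pi.single i (Pi.single j 1)) := by
      refine Prod.ext ?_ (Prod.ext ?_ ?_)
      · ext k
        fin_cases k <;> simp [Fin.sum_univ_three]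
      · ext k
        fin_cases k <;> simp [Fin.sum_univ_three]
      · ext k l
        fin_cases k <;> fin_cases l <;> simp [Fin.sum_univ_three]
    conv_lhs => rw [hdec]
    simp only [map_add, map_sum, map_smul, smul_eq_mul, mul_comm]
  have hneg := h (-c) (fun i => f (Pi.single i 1, 0, 0)) (fun j => f (0, Pi.single j 1, 0))
    (fun i j => f (0, 0, Pi.single i (Pi.single j 1))) fun α β hα hβ => by
      have := hf _ (subset_convexHull ℝ _ ⟨(α, β), ⟨hα, hβ⟩, rfl⟩)
      rw [hcoord] at this
      linarith
  rw [hcoord] at hfρ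
  linarith

theorem IsState.isSeparable_of_lenT_le {ρ : Mat4} (hρ : IsState ρ)
    (h : lenT ρ ≤ sepBound (lenA ρ + lenB ρ)) : IsSeparable ρ := by
  refine hρ.isSeparable_of_forall_blockPos fun w u v S hW => ?_
  rcases le_or_gt (lenA ρ + lenB ρ) 1 with hs | hs
  · exact hW.nonneg_of_le_sepBound hs h
  · rw [sepBound_of_one_lt hs] at h
    exact hW.nonneg_of_one_lt hρ.blockPos hs h

/-! ### Necessary conditions for separability -/

theorem abs_sum_mul_le_one {α β : Fin 3 → ℝ} (hα : ∑ i, α i ^ 2 ≤ 1) (hβ : ∑ i, β i ^ 2 ≤ 1) :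
    |∑ i, α i * β i| ≤ 1 :=
  (abs_sum_mul_le α β).trans
    (mul_le_one₀ (Real.sqrt_le_one.2 hα) (Real.sqrt_nonneg _) (Real.sqrt_le_one.2 hβ))

/-- The purity of a separable state is at most that of its marginal `ρ_B`: two product states
satisfy `(1 - α·α') (1 + β·β') ≥ 0`, and the left side is affine in the Bloch coordinates of
each. -/
theorem IsSeparable.sq_le_right {ρ : Mat4} (hρ : IsSeparable ρ) :
    ∑ i, blochA ρ i ^ 2 + ∑ i, ∑ j, corr ρ i j ^ 2 ≤ 1 + ∑ j, blochB ρ j ^ 2 := by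
  have h1 (α' β' : Fin 3 → ℝ) (hα' : ∑ i, α' i ^ 2 ≤ 1) (hβ' : ∑ j, β' j ^ 2 ≤ 1) :
      0 ≤ 1 + ∑ i, -α' i * blochA ρ i + ∑ j, β' j * blochB ρ j +
        ∑ i, ∑ j, -(α' i * β' j) * corr ρ i j := by
    refine hρ.nonneg_of_forall_product (u := fun i => -α' i) (S := fun i j => -(α' i * β' j))
      fun α β hα hβ => ?_
    have ha := (abs_le.1 (abs_sum_mul_le_one hα' hα)).2
    have hb := (abs_le.1 (abs_sum_mul_le_one hβ' hβ)).1
    refine (mul_nonneg (sub_nonneg.2 ha) (neg_le_iff_add_nonneg'.1 hb)).trans_eq ?_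
    simp only [Fin.sum_univ_three]
    ring
  have h2 := hρ.nonneg_of_forall_product (w := 1) (u := fun i => -blochA ρ i)
    (v := fun j => blochB ρ j) (S := fun i j => -corr ρ i j) fun α β hα hβ => by
      refine (h1 α β hα hβ).trans_eq ?_
      simp only [Fin.sum_univ_three]
      ring
  simp only [neg_mul, Finset.sum_neg_distrib, ← sq] at h2
  linarith

theorem IsSeparable.sq_le_left {ρ : Mat4} (hρ : IsSeparable ρ) :
    ∑ j, blochB ρ j ^ 2 + ∑ i, ∑ j, corr ρ i j ^ 2 ≤ 1 + ∑ i, blochA ρ i ^ 2 := by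
  have h1 (α' β' : Fin 3 → ℝ) (hα' : ∑ i, α' i ^ 2 ≤ 1) (hβ' : ∑ j, β' j ^ 2 ≤ 1) :
      0 ≤ 1 + ∑ i, α' i * blochA ρ i + ∑ j, -β' j * blochB ρ j +
        ∑ i, ∑ j, -(α' i * β' j) * corr ρ i j := by
    refine hρ.nonneg_of_forall_product (v := fun i => -β' i) (S := fun i j => -(α' i * β' j))
      fun α β hα hβ => ?_
    have ha := (abs_le.1 (abs_sum_mul_le_one hα' hα)).1
    have hb := (abs_le.1 (abs_sum_mul_le_one hβ' hβ)).2
    refine (mul_nonneg (neg_le_iff_add_nonneg'.1 ha) (sub_nonneg.2 hb)).trans_eq ?_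
    simp only [Fin.sum_univ_three]
    ring
  have h2 := hρ.nonneg_of_forall_product (w := 1) (v := fun i => -blochB ρ i)
    (u := fun j => blochA ρ j) (S := fun i j => -corr ρ i j) fun α β hα hβ => by
      refine (h1 α β hα hβ).trans_eq ?_
      simp only [Fin.sum_univ_three]
      ring
  simp only [neg_mul, Finset.sum_neg_distrib, ← sq] at h2
  linarith

theorem IsSeparable.lenT_sq_le {ρ : Mat4} (hρ : IsSeparable ρ) :
    lenT ρ ^ 2 ≤ 1 - |lenA ρ ^ 2 - lenB ρ ^ 2| := by
  have hl := hρ.sq_le_left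
  have hr := hρ.sq_le_right
  rw [lenT, lenA, lenB, Real.sq_sqrt (by positivity), Real.sq_sqrt (by positivity),
    Real.sq_sqrt (by positivity), le_sub_comm, abs_le]
  constructor <;> linarith

/-- Positivity of the partial transpose on the span of `|01⟩` and `|10⟩`. -/
theorem IsSeparable.sq_corr_le {ρ : Mat4} (hρ : IsSeparable ρ) :
    (corr ρ 0 0 - corr ρ 1 1) ^ 2 ≤ (1 - corr ρ 2 2) ^ 2 - (blochA ρ 2 - blochB ρ 2) ^ 2 := by
  have key (m : ℝ) : 0 ≤ (1 + blochA ρ 2 - blochB ρ 2 - corr ρ 2 2) * (m * m) +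
      (-2 * (corr ρ 0 0 - corr ρ 1 1)) * m + (1 - blochA ρ 2 + blochB ρ 2 - corr ρ 2 2) := by
    have := hρ.nonneg_of_forall_product (w := m ^ 2 + 1) (u := ![0, 0, m ^ 2 - 1])
      (v := ![0, 0, 1 - m ^ 2]) (S := ![![-2 * m, 0, 0], ![0, 2 * m, 0], ![0, 0, -(m ^ 2 + 1)]])
      fun α β hα hβ => by
        simp only [Fin.sum_univ_three] at hα hβ
        simp [Fin.sum_univ_three]
        have hα2 : |α 2| ≤ 1 := by rw [← sq_le_one_iff_abs_le_one]; nlinarith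
        have hβ2 : |β 2| ≤ 1 := by rw [← sq_le_one_iff_abs_le_one]; nlinarith
        obtain ⟨hα3, hα4⟩ := abs_le.1 hα2
        obtain ⟨hβ3, hβ4⟩ := abs_le.1 hβ2
        -- `X² + Y² ≥ 2 |X Y|` for `X² = m² (1 + α₂)(1 - β₂)` and `Y² = (1 - α₂)(1 + β₂)`
        set X := m ^ 2 * ((1 + α 2) * (1 - β 2)) with hX
        set Y := (1 - α 2) * (1 + β 2) with hY
        have hX0 : 0 ≤ X := mul_nonneg (sq_nonneg _) (mul_nonneg (by linarith) (by linarith))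
        have hY0 : 0 ≤ Y := mul_nonneg (by linarith) (by linarith)
        have hXY : (m * (α 0 * β 0 - α 1 * β 1)) ^ 2 ≤ X * Y := by
          have h1 : (α 0 * β 0 - α 1 * β 1) ^ 2 ≤ (α 0 ^ 2 + α 1 ^ 2) * (β 0 ^ 2 + β 1 ^ 2) := by
            nlinarith [sq_nonneg (α 0 * β 1 + α 1 * β 0)]
          have h2 : (α 0 ^ 2 + α 1 ^ 2) * (β 0 ^ 2 + β 1 ^ 2) ≤ (1 - α 2 ^ 2) * (1 - β 2 ^ 2) :=
            mul_le_mul (by linarith) (by linarith) (by positivity) (by nlinarith)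
          calc _ = m ^ 2 * (α 0 * β 0 - α 1 * β 1) ^ 2 := by ring
            _ ≤ m ^ 2 * ((1 - α 2 ^ 2) * (1 - β 2 ^ 2)) :=
              mul_le_mul_of_nonneg_left (h1.trans h2) (sq_nonneg m)
            _ = X * Y := by rw [hX, hY]; ring
        have h3 : 2 * (m * (α 0 * β 0 - α 1 * β 1)) ≤ X + Y := by
          refine abs_le_of_sq_le_sq' ?_ (by linarith) |>.2
          nlinarith [sq_nonneg (X - Y)]
        linarith
    simp [Fin.sum_univ_three] at this
    linarith
  have := discrim_le_zero key
  rw [discrim] at this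
  linarith

/-! ### X-states -/

/-- The matrix with Bloch vectors `A e₃`, `B e₃` and `T = diag ((p + q) / 2, (q - p) / 2, z)`. It
couples only `|00⟩` with `|11⟩`, by `p / 4`, and `|01⟩` with `|10⟩`, by `q / 4`. -/
noncomputable def xState (A B z p q : ℝ) : Mat4 :=
  ofBloch ![0, 0, A] ![0, 0, B] ![![(p + q) / 2, 0, 0], ![0, (q - p) / 2, 0], ![0, 0, z]]

theorem binary_form_nonneg {k l m : ℝ} (hk : 0 ≤ k) (hl : 0 ≤ l) (h : m ^ 2 ≤ k * l) (r s : ℝ) :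
    0 ≤ k * r ^ 2 + l * s ^ 2 + 2 * m * (r * s) := by
  have h1 : (2 * m * (r * s)) ^ 2 ≤ (k * r ^ 2 + l * s ^ 2) ^ 2 := by
    nlinarith [sq_nonneg (k * r ^ 2 - l * s ^ 2), mul_le_mul_of_nonneg_right h (sq_nonneg (r * s))]
  have := (abs_le_of_sq_le_sq' h1 (by positivity)).1
  linarith

theorem isState_xState {A B z p q : ℝ} (h1 : |A + B| ≤ 1 + z) (h2 : |A - B| ≤ 1 - z)
    (hp : p ^ 2 ≤ (1 + z) ^ 2 - (A + B) ^ 2) (hq : q ^ 2 ≤ (1 - z) ^ 2 - (A - B) ^ 2) :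
    IsState (xState A B z p q) := by
  obtain ⟨h1l, h1r⟩ := abs_le.1 h1
  obtain ⟨h2l, h2r⟩ := abs_le.1 h2
  refine ⟨.of_dotProduct_mulVec_nonneg ?_ fun x => ?_, ?_⟩
  · ext ⟨i, j⟩ ⟨k, l⟩
    fin_cases i <;> fin_cases j <;> fin_cases k <;> fin_cases l <;>
      simp [xState, ofBloch, pauli, Fin.sum_univ_three] <;> ring
  · have hP := binary_form_nonneg (k := 1 + z + (A + B)) (l := 1 + z - (A + B)) (m := p)
      (by linarith) (by linarith) (by linarith)
    have hQ := binary_form_nonneg (k := 1 - z + (A - B)) (l := 1 - z - (A - B)) (m := q)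
      (by linarith) (by linarith) (by linarith)
    have e1 := hP (x (0, 0)).re (x (1, 1)).re
    have e2 := hP (x (0, 0)).im (x (1, 1)).im
    have e3 := hQ (x (0, 1)).re (x (1, 0)).re
    have e4 := hQ (x (0, 1)).im (x (1, 0)).im
    rw [Complex.le_def]
    simp [xState, ofBloch, pauli, Fin.sum_univ_three, dotProduct, Matrix.mulVec,
      Fintype.sum_prod_type]
    constructor
    · linarith
    · ring
  · simp [xState, ofBloch, pauli, Fin.sum_univ_three, Matrix.trace, Fintype.sum_prod_type]
    ring

theorem isEntangled_xState {A B z p q : ℝ} (h1 : |A + B| ≤ 1 + z) (h2 : |A - B| ≤ 1 - z)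
    (hp : p ^ 2 ≤ (1 + z) ^ 2 - (A + B) ^ 2) (hq : q ^ 2 ≤ (1 - z) ^ 2 - (A - B) ^ 2)
    (hent : (1 - z) ^ 2 - (A - B) ^ 2 < p ^ 2) : IsEntangled (xState A B z p q) := by
  refine ⟨isState_xState h1 h2 hp hq, fun h => ?_⟩
  have := h.sq_corr_le
  simp only [xState, blochA_ofBloch, blochB_ofBloch, corr_ofBloch] at this
  simp at this
  ring_nf at this hent
  linarith

theorem lenA_xState (A B z p q : ℝ) : lenA (xState A B z p q) = |A| := by
  simp [lenA, xState, blochA_ofBloch, Fin.sum_univ_three, Real.sqrt_sq_eq_abs]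

theorem lenB_xState (A B z p q : ℝ) : lenB (xState A B z p q) = |B| := by
  simp [lenB, xState, blochB_ofBloch, Fin.sum_univ_three, Real.sqrt_sq_eq_abs]

theorem lenT_xState (A B z p q : ℝ) :
    lenT (xState A B z p q) = √(z ^ 2 + (p ^ 2 + q ^ 2) / 2) := by
  simp only [lenT, xState, corr_ofBloch]
  congr 1
  simp [Fin.sum_univ_three]
  ring

/-! ### Entangled states with prescribed lengths -/

/-- For a given `z`, the X-states with Bloch lengths `|A|`, `|B|` are entangled for some `p`, `q`
as soon as `t²` lies between the two bounds; `p` is taken as large as positivity and `t` permit. -/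
theorem exists_isEntangled_of_bounds {A B z t : ℝ} (ht : 0 ≤ t) (h1 : |A + B| ≤ 1 + z)
    (h2 : |A - B| ≤ 1 - z) (hz : A * B < z)
    (hlow : (1 - z) ^ 2 - (A - B) ^ 2 < 2 * (t ^ 2 - z ^ 2))
    (hupp : t ^ 2 ≤ 1 + 2 * z ^ 2 - A ^ 2 - B ^ 2) :
    ∃ ρ, IsEntangled ρ ∧ lenA ρ = |A| ∧ lenB ρ = |B| ∧ lenT ρ = t := by
  have hL : 0 ≤ (1 - z) ^ 2 - (A - B) ^ 2 := sub_nonneg.2 (sq_le_sq.2 (h2.trans (le_abs_self _)))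
  have hU : 0 ≤ (1 + z) ^ 2 - (A + B) ^ 2 := sub_nonneg.2 (sq_le_sq.2 (h1.trans (le_abs_self _)))
  set R := 2 * (t ^ 2 - z ^ 2) with hR
  set U := (1 + z) ^ 2 - (A + B) ^ 2 with hUdef
  set L := (1 - z) ^ 2 - (A - B) ^ 2 with hLdef
  have hm : 0 ≤ min R U := le_min (by linarith) hU
  have hq0 : 0 ≤ R - min R U := sub_nonneg.2 (min_le_left _ _)
  have hqL : R - min R U ≤ L := by
    rcases min_cases R U with ⟨h, _⟩ | ⟨h, _⟩ <;> rw [h] <;> nlinarith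
  refine ⟨xState A B z √(min R U) √(R - min R U), isEntangled_xState h1 h2 ?_ ?_ ?_,
    lenA_xState .., lenB_xState .., ?_⟩
  · rw [Real.sq_sqrt hm]
    exact min_le_right _ _
  · rwa [Real.sq_sqrt hq0]
  · rw [Real.sq_sqrt hm]
    exact lt_min hlow (by linarith)
  · rw [lenT_xState, Real.sq_sqrt hm, Real.sq_sqrt hq0, hR]
    ring_nf
    exact Real.sqrt_sq ht

/-- The lower bound on `t²` in `exists_isEntangled_of_bounds`, for antiparallel Bloch vectors, is a
parabola in `z` with vertex `1 / 3`. Its minimum over the admissible `z ≤ 1 - (x + y)` is the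
square of `sepBound`. -/
theorem exists_sepBound_sq_eq {x y : ℝ} (hx : 0 ≤ x) (hx1 : x < 1) (hy : 0 ≤ y) (hy1 : y < 1) :
    ∃ z ≤ 1 - (x + y), -(x * y) < z ∧
      (1 - z) ^ 2 - (x + y) ^ 2 = 2 * (sepBound (x + y) ^ 2 - z ^ 2) := by
  have hxy := mul_nonneg hx hy
  rcases le_or_gt (x + y) (2 / 3) with h | h
  · refine ⟨1 / 3, by linarith, by linarith, ?_⟩
    rw [sepBound, if_pos h, Real.sq_sqrt (by nlinarith)]
    ring
  · refine ⟨1 - (x + y), le_rfl, by nlinarith, ?_⟩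
    rw [sepBound, if_neg h.not_ge]
    split_ifs <;> ring

theorem sub_one_le_sepBound (s : ℝ) : s - 1 ≤ sepBound s := by
  rcases le_or_gt s 1 with h | h
  · linarith [sepBound_nonneg s]
  · rw [sepBound_of_one_lt h]

/-- Every triple of lengths above the bound that separable states can have is also the triple of
an entangled state. -/
theorem exists_isEntangled {x y t : ℝ} (hx : 0 ≤ x) (hx1 : x < 1) (hy : 0 ≤ y) (hy1 : y < 1)
    (hlow : sepBound (x + y) < t) (hupp : t ^ 2 ≤ 1 - |x ^ 2 - y ^ 2|) :
    ∃ ρ, IsEntangled ρ ∧ lenA ρ = x ∧ lenB ρ = y ∧ lenT ρ = t := by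
  have hf := sepBound_nonneg (x + y)
  have ht : 0 ≤ t := hf.trans hlow.le
  have hft : sepBound (x + y) ^ 2 < t ^ 2 := pow_lt_pow_left₀ hlow hf two_ne_zero
  have hxy := mul_nonneg hx hy
  have hw : 0 < (1 - x) * (1 - y) := mul_pos (by linarith) (by linarith)
  have hxy' : 0 ≤ (1 - x) * y := mul_nonneg (by linarith) hy
  have hyx' : 0 ≤ (1 - y) * x := mul_nonneg (by linarith) hx
  have hd : |x - y| ≤ 1 - x * y := abs_le.2 ⟨by linarith, by linarith⟩
  have hs : |x + y| = x + y := abs_of_nonneg (by linarith)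
  -- the two families of X-states, with antiparallel and with parallel Bloch vectors
  have anti {z : ℝ} (h1 : -(x * y) < z) (h2 : z ≤ 1 - (x + y))
      (h3 : (1 - z) ^ 2 - (x + y) ^ 2 < 2 * (t ^ 2 - z ^ 2))
      (h4 : t ^ 2 ≤ 1 + 2 * z ^ 2 - x ^ 2 - y ^ 2) :
      ∃ ρ, IsEntangled ρ ∧ lenA ρ = x ∧ lenB ρ = y ∧ lenT ρ = t := by
    have := exists_isEntangled_of_bounds (A := x) (B := -y) (z := z) ht
      (by rw [← sub_eq_add_neg]; linarith) (by rw [sub_neg_eq_add, hs]; linarith) (by linarith)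
      (by rwa [sub_neg_eq_add]) (by rwa [neg_sq])
    rwa [abs_neg, abs_of_nonneg hx, abs_of_nonneg hy] at this
  have para {z : ℝ} (h1 : x * y < z) (h2 : |x - y| ≤ 1 - z)
      (h3 : (1 - z) ^ 2 - (x - y) ^ 2 < 2 * (t ^ 2 - z ^ 2))
      (h4 : t ^ 2 ≤ 1 + 2 * z ^ 2 - x ^ 2 - y ^ 2) :
      ∃ ρ, IsEntangled ρ ∧ lenA ρ = x ∧ lenB ρ = y ∧ lenT ρ = t := by
    have := exists_isEntangled_of_bounds (A := x) (B := y) (z := z) ht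
      (by rw [hs]; linarith) h2 h1 h3 h4
    rwa [abs_of_nonneg hx, abs_of_nonneg hy] at this
  obtain ⟨z₀, hz₀, hz₀', hf₀⟩ := exists_sepBound_sq_eq hx hx1 hy hy1
  set r := (t ^ 2 - 1 + x ^ 2 + y ^ 2) / 2 with hr
  rcases le_or_gt (t ^ 2) (1 + 2 * z₀ ^ 2 - x ^ 2 - y ^ 2) with hA | hA
  · exact anti hz₀' hz₀ (by linarith) hA
  rcases lt_or_ge (t ^ 2) (1 + 2 * (x * y) ^ 2 - x ^ 2 - y ^ 2) with hB | hB
  · -- the state of rank two with `z² = r`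
    have h1 : z₀ ^ 2 < r := by linarith
    have h2 : √r < x * y := by
      rw [Real.sqrt_lt' (by nlinarith [sq_nonneg z₀])]
      linarith
    have h3 : |z₀| < √r := Real.lt_sqrt (abs_nonneg _) |>.2 (by rwa [sq_abs])
    have h4 : (-√r) ^ 2 = r := by
      rw [neg_sq, Real.sq_sqrt ((sq_nonneg _).trans h1.le)]
    refine anti (z := -√r) (by linarith) (by linarith [neg_abs_le z₀]) ?_ ?_
    · have := sq_lt_sq' (a := x - y) (b := 1 + -√r) (by linarith [(abs_le.1 hd).1])
        (by linarith [(abs_le.1 hd).2])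
      linarith
    · linarith
  · -- a step beyond `z = x y`, where the range of admissible `t` has positive length
    set δ := (1 - x) * (1 - y) / 8 with hδ
    have hδ0 : 0 < δ := by linarith
    have hδ1 : δ ≤ 1 / 8 := by linarith
    rcases le_or_gt (t ^ 2) (1 + 2 * (x * y + δ) ^ 2 - x ^ 2 - y ^ 2) with hC | hC
    · refine para (z := x * y + δ) (by linarith) (abs_le.2 ⟨?_, ?_⟩) ?_ hC
      · linarith
      · linarith
      · have h1 : x * y ≤ 1 := by linarith
        have h2 : 8 * δ ≤ (1 - x ^ 2) * (1 - y ^ 2) := by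
          have h3 : (1 - x ^ 2) * (1 - y ^ 2) = 8 * δ * (1 + (x + y + x * y)) := by
            rw [hδ]; ring
          rw [h3]
          exact le_mul_of_one_le_right (by linarith) (by linarith)
        have h4 : x * y * δ ≤ δ := mul_le_of_le_one_left hδ0.le h1
        have h5 : δ * δ ≤ δ := mul_le_of_le_one_left hδ0.le (by linarith)
        have h6 : (1 - (x * y + δ)) ^ 2 - (x - y) ^ 2 + (1 - x ^ 2) * (1 - y ^ 2) + 2 * δ -
            6 * (x * y * δ) - 3 * (δ * δ) =
            2 * ((1 + 2 * (x * y) ^ 2 - x ^ 2 - y ^ 2) - (x * y + δ) ^ 2) := by ring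
        linarith
    · have h1 : (x * y + δ) ^ 2 < r := by linarith
      have h0 : 0 ≤ r := (sq_nonneg _).trans h1.le
      have h2 : x * y + δ < √r := Real.lt_sqrt (by linarith) |>.2 h1
      have h3 := Real.sq_sqrt h0
      have h4 : √r ≤ x := Real.sqrt_le_iff.2
        ⟨hx, by linarith [neg_abs_le (x ^ 2 - y ^ 2)]⟩
      have h5 : √r ≤ y := Real.sqrt_le_iff.2
        ⟨hy, by linarith [le_abs_self (x ^ 2 - y ^ 2)]⟩
      refine para (z := √r) (by linarith) (abs_le.2 ⟨by linarith, by linarith⟩) ?_ (by linarith)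
      have := sq_lt_sq' (a := x + y) (b := 1 + √r) (by linarith) (by linarith)
      linarith

/-- Just above the bound there are lengths that `exists_isEntangled` can realise. -/
theorem sepBound_sq_lt {x y : ℝ} (hx : 0 ≤ x) (hx1 : x < 1) (hy : 0 ≤ y) (hy1 : y < 1) :
    sepBound (x + y) ^ 2 < 1 - |x ^ 2 - y ^ 2| := by
  rw [lt_sub_comm, abs_lt]
  rcases le_or_gt (x + y) (2 / 3) with h | h
  · rw [sepBound, if_pos h, Real.sq_sqrt (by nlinarith)]
    constructor <;> nlinarith
  · have hsq : sepBound (x + y) ^ 2 = (1 - (x + y)) ^ 2 := by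
      rw [sepBound, if_neg h.not_ge]
      split_ifs <;> ring
    rw [hsq]
    have h1 : 0 < (x + y) * (1 - x) := mul_pos (by linarith) (by linarith)
    have h2 : 0 < (x + y) * (1 - y) := mul_pos (by linarith) (by linarith)
    constructor <;> linarith

end TwoQubit

theorem mainTheorem4 :
    -- the condition is sufficient for separability
    (∀ ρ : TwoQubit.Mat4, TwoQubit.IsState ρ →
      TwoQubit.lenT ρ ≤ TwoQubit.sepBound (TwoQubit.lenA ρ + TwoQubit.lenB ρ) →
      TwoQubit.IsSeparable ρ) ∧
    -- it is implied by every sufficient condition that only involves the three lengths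
    (∀ P : ℝ → ℝ → ℝ → Prop,
      (∀ ρ : TwoQubit.Mat4, TwoQubit.IsState ρ →
        P (TwoQubit.lenA ρ) (TwoQubit.lenB ρ) (TwoQubit.lenT ρ) → TwoQubit.IsSeparable ρ) →
      ∀ ρ : TwoQubit.Mat4, TwoQubit.IsState ρ →
        P (TwoQubit.lenA ρ) (TwoQubit.lenB ρ) (TwoQubit.lenT ρ) →
        TwoQubit.lenT ρ ≤ TwoQubit.sepBound (TwoQubit.lenA ρ + TwoQubit.lenB ρ)) ∧
    -- there are entangled states arbitrarily close to every point of the boundary surface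
    (∀ x y ε : ℝ, 0 ≤ x → x < 1 → 0 ≤ y → y < 1 → 0 < ε →
      ∃ ρ : TwoQubit.Mat4, TwoQubit.IsEntangled ρ ∧
        TwoQubit.lenA ρ = x ∧ TwoQubit.lenB ρ = y ∧
        TwoQubit.sepBound (x + y) < TwoQubit.lenT ρ ∧
        TwoQubit.lenT ρ < TwoQubit.sepBound (x + y) + ε) := by
  refine ⟨fun ρ hρ h => hρ.isSeparable_of_lenT_le h, fun P hP ρ hρ hPρ => ?_,
    fun x y ε hx hx1 hy hy1 hε => ?_⟩
  · by_contra! hlt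
    have hsep := hP ρ hρ hPρ
    have hbound := hsep.lenT_sq_le
    have hA0 : 0 ≤ TwoQubit.lenA ρ := Real.sqrt_nonneg _
    have hB0 : 0 ≤ TwoQubit.lenB ρ := Real.sqrt_nonneg _
    have hT0 : 0 ≤ TwoQubit.lenT ρ := Real.sqrt_nonneg _
    have hA1 : TwoQubit.lenA ρ ≤ 1 := hρ.blockPos.sqrt_left_le
    have hB1 : TwoQubit.lenB ρ ≤ 1 := hρ.blockPos.swap.sqrt_left_le
    rcases hA1.eq_or_lt with hA | hA
    · -- a pure marginal forces `‖T‖ = ‖b‖`, which is the bound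
      rw [hA] at hlt hbound
      have h1 : TwoQubit.lenT ρ ≤ TwoQubit.lenB ρ :=
        (pow_le_pow_iff_left₀ hT0 hB0 two_ne_zero).1
          (by linarith [le_abs_self ((1 : ℝ) ^ 2 - TwoQubit.lenB ρ ^ 2)])
      linarith [TwoQubit.sub_one_le_sepBound (1 + TwoQubit.lenB ρ)]
    rcases hB1.eq_or_lt with hB | hB
    · rw [hB] at hlt hbound
      have h1 : TwoQubit.lenT ρ ≤ TwoQubit.lenA ρ :=
        (pow_le_pow_iff_left₀ hT0 hA0 two_ne_zero).1
          (by linarith [neg_abs_le (TwoQubit.lenA ρ ^ 2 - (1 : ℝ) ^ 2)])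
      linarith [TwoQubit.sub_one_le_sepBound (TwoQubit.lenA ρ + 1)]
    obtain ⟨ρ', hent, h1, h2, h3⟩ := TwoQubit.exists_isEntangled hA0 hA hB0 hB hlt hbound
    exact hent.2 (hP ρ' hent.1 (by rwa [h1, h2, h3]))
  · have hf := TwoQubit.sepBound_nonneg (x + y)
    obtain ⟨t, ht, ht'⟩ := exists_between (lt_min (lt_add_of_pos_right _ hε)
      (Real.lt_sqrt hf |>.2 (TwoQubit.sepBound_sq_lt hx hx1 hy hy1)))
    obtain ⟨ht1, ht2⟩ := lt_min_iff.1 ht'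
    obtain ⟨ρ, hent, h1, h2, h3⟩ := TwoQubit.exists_isEntangled hx hx1 hy hy1 ht
      ((Real.lt_sqrt (hf.trans ht.le)).1 ht2).le
    exact ⟨ρ, hent, h1, h2, h3 ▸ ht, h3 ▸ ht1⟩
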